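/- Let $n\in\mathbb N$, $\varepsilon>0$, and let $\psi:\mathbb R\to[0,\infty)$ be a convex function which is increasing on $[0,\infty)$ and satisfies, for all $y\in\mathbb R$, $$\psi\in C^2(\mathbb R),\qquad \psi(-y)=\psi(y),\quad \psi(0)=0,\qquad |\psi'(y)|\le\nu_1,\qquad \psi(y)\ge\nu_2|y|-\nu_3,\qquad \psi''(y)>0,$$ with constants $\nu_1,\nu_2>0$ and $\nu_3\in\mathbb R$. For $p\in\mathbb R^{n\times n}$ let $\sigma_1(p),\dots,\sigma_n(p)$ denote the eigenvalues of the symmetric matrix $pp^T$, counted with multiplicity. Then the function $$F^*:\mathbb R^{n\times n}\to\mathbb R,\qquad F^*(p):=\sum_{i=1}^n\psi\Big(\big(\varepsilon^2+\sigma_i(p)^2\big)^{1/4}\Big),$$ is convex and of class $C^2$ on $\mathbb R^{n\times n}$. -/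

import Mathlib

-- The space of real `n × n` matrices carries its Euclidean (Frobenius) norm.
attribute [local instance] Matrix.frobeniusNormedAddCommGroup Matrix.frobeniusNormedSpace

theorem mul_transpose_isHermitian {n : ℕ} (p : Matrix (Fin n) (Fin n) ℝ) :
    (p * p.transpose).IsHermitian := by
  rw [← Matrix.conjTranspose_eq_transpose_of_trivial]
  exact Matrix.isHermitian_mul_conjTranspose_self p

/-- The eigenvalues `σ_i(p)`, `i = 1, …, n`, of the symmetric matrix `p pᵀ`,
listed with multiplicity. -/
noncomputable def sigma {n : ℕ} (p : Matrix (Fin n) (Fin n) ℝ) : Fin n → ℝ :=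
  (mul_transpose_isHermitian p).eigenvalues

/-- The density `F*(p) = ∑ i, ψ ((ε² + σ_i(p)²) ^ (1/4))`. -/
noncomputable def Fstar {n : ℕ} (ψ : ℝ → ℝ) (ε : ℝ) (p : Matrix (Fin n) (Fin n) ℝ) : ℝ :=
  ∑ i, ψ ((ε ^ 2 + sigma p i ^ 2) ^ (1 / 4 : ℝ))

/-- The assumptions on the generating function `ψ : ℝ → [0, ∞)`: it is convex, increasing on
`[0, ∞)`, even, of class `C²`, vanishes at `0`, has linear growth, and `ψ'' > 0`. -/
structure IsGenerator (ψ : ℝ → ℝ) (ν₁ ν₂ ν₃ : ℝ) : Prop where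
  nonneg : ∀ y, 0 ≤ ψ y
  convex : ConvexOn ℝ Set.univ ψ
  increasing : MonotoneOn ψ (Set.Ici 0)
  contDiff : ContDiff ℝ 2 ψ
  even : ∀ y, ψ (-y) = ψ y
  map_zero : ψ 0 = 0
  abs_deriv_le : ∀ y, |deriv ψ y| ≤ ν₁
  le_apply : ∀ y, ν₂ * |y| - ν₃ ≤ ψ y
  deriv2_pos : ∀ y, 0 < deriv (deriv ψ) y

/-! With `h s = ψ ((ε² + s⁴)^(1/4))`, which is even, convex and `C²` (as `ε > 0`), `F*` is the sum
of `h` over the singular values `√σ_i`. Convexity: the singular values of a convex combination are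
its diagonal entries in suitable orthonormal bases. Diagonal entries are linear in the matrix, and
in any bases the sum of `h` over them is at most `singularSum h` (`sum_map_inner_le_singularSum`).
Regularity is deduced from convexity. If an even polynomial `P` has `|P''| ≤ η` on `[-R, R]`, then
`(η/2) s² ± P` is convex there, so `(η/2)‖p‖² ± singularSum P` is convex on the ball of radius `R`,
which bounds the Hessian of `singularSum P` (`norm_fderiv_fderiv_tracePoly_le`). Even polynomials
whose second derivatives approximate `h''` thus give smooth functions `tr Q(p pᵀ)` with uniformly
Cauchy Hessians, and their limit `singularSum h` is `C²`. -/

/-! ### Singular values and convexity of spectral sums -/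

open Matrix in
theorem inner_toEuclideanLin_right {n : ℕ} (q : Matrix (Fin n) (Fin n) ℝ)
    (x y : EuclideanSpace ℝ (Fin n)) :
    inner ℝ x (toEuclideanLin q y) = inner ℝ (toEuclideanLin qᵀ x) y := by
  rw [← Matrix.conjTranspose_eq_transpose_of_trivial, toEuclideanLin_conjTranspose_eq_adjoint,
    LinearMap.adjoint_inner_left]

theorem sigma_nonneg {n : ℕ} (p : Matrix (Fin n) (Fin n) ℝ) (i : Fin n) : 0 ≤ sigma p i := by
  have h : (p * p.transpose).PosSemidef := by
    rw [← Matrix.conjTranspose_eq_transpose_of_trivial]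
    exact Matrix.posSemidef_self_mul_conjTranspose p
  exact h.eigenvalues_nonneg i

open Matrix in
/-- Singular value decomposition of a square real matrix. -/
theorem exists_singular_bases {n : ℕ} (q : Matrix (Fin n) (Fin n) ℝ) :
    ∃ a b : OrthonormalBasis (Fin n) ℝ (EuclideanSpace ℝ (Fin n)),
      ∀ j, toEuclideanLin qᵀ (a j) = √(sigma q j) • b j := by
  let a := (mul_transpose_isHermitian q).eigenvectorBasis
  have ha : ∀ j, toEuclideanLin q (toEuclideanLin qᵀ (a j)) = sigma q j • a j := by
    intro j
    have := (mul_transpose_isHermitian q).mulVec_eigenvectorBasis j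
    rw [← mulVec_mulVec] at this
    exact (WithLp.ofLp_injective 2) this
  have hin : ∀ i j, inner ℝ (toEuclideanLin qᵀ (a i)) (toEuclideanLin qᵀ (a j))
      = if i = j then sigma q j else 0 := by
    intro i j
    rw [← inner_toEuclideanLin_right, ha, inner_smul_right, orthonormal_iff_ite.1 a.orthonormal]
    simp
  have hsq : ∀ i, √(sigma q i) * √(sigma q i) = sigma q i :=
    fun i => Real.mul_self_sqrt (sigma_nonneg q i)
  -- Normalised images are orthonormal only where `σ ≠ 0`; the remaining `b j` are free, since there
  -- `qᵀ (a j) = 0`.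
  let s : Set (Fin n) := {j | sigma q j ≠ 0}
  let v : Fin n → EuclideanSpace ℝ (Fin n) := fun j => (√(sigma q j))⁻¹ • toEuclideanLin qᵀ (a j)
  have hv : Orthonormal ℝ (s.domRestrict v) := by
    rw [orthonormal_iff_ite]
    rintro ⟨i, hi⟩ ⟨j, hj⟩
    simp only [Set.domRestrict_apply, v, inner_smul_left, inner_smul_right, hin, Subtype.mk.injEq]
    split_ifs with h
    · subst h
      have h0 : √(sigma q i) ≠ 0 := fun h => hi (by rw [← hsq, h, mul_zero])
      simp only [conj_trivial]
      nth_rewrite 3 [← hsq i]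
      field_simp
    · simp
  obtain ⟨b, hb⟩ := hv.exists_orthonormalBasis_extension_of_card_eq (by simp)
  refine ⟨a, b, fun j => ?_⟩
  by_cases hj : sigma q j = 0
  · have := hin j j
    rw [if_pos rfl, hj, inner_self_eq_zero] at this
    rw [this, hj]; simp
  · rw [hb j hj]
    have h0 : √(sigma q j) ≠ 0 := fun h => hj (by rw [← hsq, h, mul_zero])
    simp only [v]
    rw [smul_smul, mul_inv_cancel₀ h0, one_smul]

/-- The sum of `h` over the singular values of a square matrix. -/
noncomputable def singularSum {n : ℕ} (h : ℝ → ℝ) (p : Matrix (Fin n) (Fin n) ℝ) : ℝ :=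
  ∑ i, h √(sigma p i)

/-- Jensen's inequality with weights `(w j ± c j) / 2` at the points `± s j`, where `h` takes equal
values. -/
theorem ConvexOn.map_signed_sum_le {ι : Type*} [Fintype ι] {h : ℝ → ℝ} {R : ℝ}
    (hconv : ConvexOn ℝ (Set.Icc (-R) R) h) (heven : ∀ s, h (-s) = h s)
    {w c s : ι → ℝ} (hw : ∑ j, w j = 1) (hc : ∀ j, |c j| ≤ w j) (hs : ∀ j, |s j| ≤ R) :
    h (∑ j, c j * s j) ≤ ∑ j, w j * h (s j) ∧ ∑ j, c j * s j ∈ Set.Icc (-R) R := by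
  let W : ι × Bool → ℝ := fun x => bif x.2 then (w x.1 + c x.1) / 2 else (w x.1 - c x.1) / 2
  let X : ι × Bool → ℝ := fun x => bif x.2 then s x.1 else - s x.1
  have hW0 : ∀ x ∈ Finset.univ, 0 ≤ W x := by
    rintro ⟨j, b⟩ -
    have := abs_le.1 (hc j)
    cases b <;> simp only [W, cond_true, cond_false] <;> linarith
  have hW1 : ∑ x, W x = 1 := by
    rw [Fintype.sum_prod_type, ← hw]
    refine Finset.sum_congr rfl fun j _ => ?_
    simp only [W, Fintype.sum_bool, cond_true, cond_false]; ring
  have hX : ∀ x ∈ Finset.univ, X x ∈ Set.Icc (-R) R := by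
    rintro ⟨j, b⟩ -
    have := abs_le.1 (hs j)
    cases b <;> simp only [X, cond_true, cond_false] <;> constructor <;> linarith
  have hsum : ∑ x, W x • X x = ∑ j, c j * s j := by
    rw [Fintype.sum_prod_type]
    refine Finset.sum_congr rfl fun j _ => ?_
    simp only [W, X, Fintype.sum_bool, cond_true, cond_false, smul_eq_mul]; ring
  have hsum' : ∑ x, W x • h (X x) = ∑ j, w j * h (s j) := by
    rw [Fintype.sum_prod_type]
    refine Finset.sum_congr rfl fun j _ => ?_
    simp only [W, X, Fintype.sum_bool, cond_true, cond_false, smul_eq_mul, heven]; ring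
  constructor
  · rw [← hsum, ← hsum']
    exact hconv.map_sum_le hW0 hW1 hX
  · rw [← hsum]
    exact (convex_Icc _ _).sum_mem hW0 hW1 hX

open Matrix in
theorem sum_map_inner_le_singularSum {n : ℕ} {h : ℝ → ℝ} {R : ℝ}
    (hconv : ConvexOn ℝ (Set.Icc (-R) R) h) (heven : ∀ s, h (-s) = h s)
    (q : Matrix (Fin n) (Fin n) ℝ) (hq : ∀ j, √(sigma q j) ≤ R)
    (u v : OrthonormalBasis (Fin n) ℝ (EuclideanSpace ℝ (Fin n))) :
    ∑ i, h (inner ℝ (toEuclideanLin qᵀ (u i)) (v i)) ≤ singularSum h q ∧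
      ∀ i, inner ℝ (toEuclideanLin qᵀ (u i)) (v i) ∈ Set.Icc (-R) R := by
  obtain ⟨a, b, hab⟩ := exists_singular_bases q
  -- By Parseval `w` is doubly stochastic, and it dominates `|c|` by the arithmetic-geometric mean
  -- inequality.
  let w : Fin n → Fin n → ℝ := fun i j => (inner ℝ (a j) (u i) ^ 2 + inner ℝ (b j) (v i) ^ 2) / 2
  let c : Fin n → Fin n → ℝ := fun i j => inner ℝ (a j) (u i) * inner ℝ (b j) (v i)
  have hc : ∀ i j, |c i j| ≤ w i j := by
    intro i j
    rw [abs_le]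
    constructor <;> simp only [c, w] <;>
      nlinarith [sq_nonneg (inner ℝ (a j) (u i) + inner ℝ (b j) (v i)),
        sq_nonneg (inner ℝ (a j) (u i) - inner ℝ (b j) (v i))]
  have hw1 : ∀ i, ∑ j, w i j = 1 := by
    intro i
    simp only [w]
    rw [← Finset.sum_div, Finset.sum_add_distrib, a.sum_sq_inner_right, b.sum_sq_inner_right]
    simp
  have hw2 : ∀ j, ∑ i, w i j = 1 := by
    intro j
    simp only [w]
    rw [← Finset.sum_div, Finset.sum_add_distrib, u.sum_sq_inner_left, v.sum_sq_inner_left]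
    simp
  have hs : ∀ j, |√(sigma q j)| ≤ R := fun j => by
    rw [abs_of_nonneg (Real.sqrt_nonneg _)]; exact hq j
  have hx : ∀ i, inner ℝ (toEuclideanLin qᵀ (u i)) (v i) = ∑ j, c i j * √(sigma q j) := by
    intro i
    conv_lhs => rw [← a.sum_repr' (u i)]
    rw [map_sum, sum_inner]
    refine Finset.sum_congr rfl fun j _ => ?_
    rw [map_smul, hab, inner_smul_left, inner_smul_left]
    simp only [conj_trivial, c]; ring
  have key := fun i => hconv.map_signed_sum_le heven (hw1 i) (hc i) hs
  refine ⟨?_, fun i => by rw [hx]; exact (key i).2⟩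
  calc ∑ i, h (inner ℝ (toEuclideanLin qᵀ (u i)) (v i))
      ≤ ∑ i, ∑ j, w i j * h √(sigma q j) :=
        Finset.sum_le_sum fun i _ => by rw [hx]; exact (key i).1
    _ = singularSum h q := by
        rw [Finset.sum_comm]
        refine Finset.sum_congr rfl fun j _ => ?_
        rw [← Finset.sum_mul, hw2, one_mul]

-- Convexity of `h` is asked only on `[-R, R]` so that the result also covers polynomials controlled
-- only there.
open Matrix in
theorem convexOn_singularSum {n : ℕ} {h : ℝ → ℝ} {R : ℝ}
    (hconv : ConvexOn ℝ (Set.Icc (-R) R) h) (heven : ∀ s, h (-s) = h s)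
    {S : Set (Matrix (Fin n) (Fin n) ℝ)} (hS : Convex ℝ S)
    (hSR : ∀ q ∈ S, ∀ j, √(sigma q j) ≤ R) : ConvexOn ℝ S (singularSum h) := by
  refine ⟨hS, fun p hp q hq s t hs ht hst => ?_⟩
  obtain ⟨a, b, hab⟩ := exists_singular_bases (s • p + t • q)
  obtain ⟨hp1, hp2⟩ := sum_map_inner_le_singularSum hconv heven p (hSR p hp) a b
  obtain ⟨hq1, hq2⟩ := sum_map_inner_le_singularSum hconv heven q (hSR q hq) a b
  have hx : ∀ j, √(sigma (s • p + t • q) j) = s • inner ℝ (toEuclideanLin pᵀ (a j)) (b j)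
      + t • inner ℝ (toEuclideanLin qᵀ (a j)) (b j) := by
    intro j
    have : inner ℝ (toEuclideanLin (s • p + t • q)ᵀ (a j)) (b j) = √(sigma (s • p + t • q) j) := by
      rw [hab, inner_smul_left, real_inner_self_eq_norm_sq]; simp
    rw [← this, transpose_add, transpose_smul, transpose_smul, map_add, map_smul, map_smul,
      LinearMap.add_apply, inner_add_left, LinearMap.smul_apply, LinearMap.smul_apply,
      inner_smul_left, inner_smul_left]
    simp
  calc singularSum h (s • p + t • q)
      ≤ ∑ j, (s • h (inner ℝ (toEuclideanLin pᵀ (a j)) (b j))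
        + t • h (inner ℝ (toEuclideanLin qᵀ (a j)) (b j))) :=
        Finset.sum_le_sum fun j _ => by
          rw [hx]; exact hconv.2 (hp2 j) (hq2 j) hs ht hst
    _ = s • ∑ j, h (inner ℝ (toEuclideanLin pᵀ (a j)) (b j))
        + t • ∑ j, h (inner ℝ (toEuclideanLin qᵀ (a j)) (b j)) := by
        rw [Finset.sum_add_distrib, Finset.smul_sum, Finset.smul_sum]
    _ ≤ s • singularSum h p + t • singularSum h q := by
        simp only [smul_eq_mul]; gcongr

/-! ### Traces and the Frobenius norm -/

open Matrix Polynomial in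
theorem trace_aeval_mul_transpose {n : ℕ} (Q : ℝ[X]) (p : Matrix (Fin n) (Fin n) ℝ) :
    (aeval (p * pᵀ) Q).trace = ∑ i, Q.eval (sigma p i) := by
  have hA := mul_transpose_isHermitian p
  have h1 : aeval (p * pᵀ) Q = Unitary.conjStarAlgAut ℝ _ hA.eigenvectorUnitary
      (diagonal fun i => Q.eval (sigma p i)) := by
    have h2 : (diagonal fun i => Q.eval (sigma p i)) = aeval (diagonal (sigma p)) Q := by
      have := aeval_algHom_apply (Matrix.diagonalAlgHom ℝ (n := Fin n) (α := ℝ)) (sigma p) Q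
      simp only [diagonalAlgHom_apply] at this
      rw [this]
      congr 1
      ext i
      simp
    rw [h2]
    conv_lhs => rw [hA.spectral_theorem]
    exact aeval_algHom_apply ((Unitary.conjStarAlgAut ℝ (Matrix (Fin n) (Fin n) ℝ)
      hA.eigenvectorUnitary).toAlgEquiv.toAlgHom) (diagonal (sigma p)) Q
  rw [h1, Unitary.conjStarAlgAut_apply, trace_mul_cycle, Unitary.coe_star_mul_self, one_mul,
    trace_diagonal]

open Matrix in
theorem sum_sigma {n : ℕ} (p : Matrix (Fin n) (Fin n) ℝ) : ∑ i, sigma p i = (p * pᵀ).trace := by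
  simpa using (trace_aeval_mul_transpose Polynomial.X p).symm

open Matrix in
theorem trace_mul_transpose_self {n : ℕ} (p : Matrix (Fin n) (Fin n) ℝ) :
    (p * pᵀ).trace = ‖p‖ ^ 2 := by
  rw [frobenius_norm_def, ← Real.sqrt_eq_rpow, Real.sq_sqrt (by positivity)]
  simp [Matrix.trace, Matrix.mul_apply, sq]

theorem sqrt_sigma_le_norm {n : ℕ} (p : Matrix (Fin n) (Fin n) ℝ) (j : Fin n) :
    √(sigma p j) ≤ ‖p‖ := by
  rw [Real.sqrt_le_left (norm_nonneg _), ← trace_mul_transpose_self, ← sum_sigma]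
  exact Finset.single_le_sum (fun i _ => sigma_nonneg p i) (Finset.mem_univ j)

/-! ### Second derivatives and their uniform limits -/

section Calculus

variable {E : Type*} [NormedAddCommGroup E] [NormedSpace ℝ E]

theorem hasDerivAt_fderiv_comp_line {f : E → ℝ} (hf : ContDiff ℝ 2 f) (x v : E) (t : ℝ) :
    HasDerivAt (fun t : ℝ => f (x + t • v)) (fderiv ℝ f (x + t • v) v) t ∧
      HasDerivAt (fun t : ℝ => fderiv ℝ f (x + t • v) v)
        (fderiv ℝ (fderiv ℝ f) (x + t • v) v v) t := by
  have hl : HasDerivAt (fun t : ℝ => x + t • v) v t := by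
    simpa using ((hasDerivAt_id t).smul_const v).const_add x
  have h1 : DifferentiableAt ℝ f (x + t • v) := (hf.differentiable (by norm_num)) _
  have h2 : DifferentiableAt ℝ (fderiv ℝ f) (x + t • v) :=
    ((hf.fderiv_right (m := 1) (by norm_num)).differentiable (by norm_num)) _
  refine ⟨h1.hasFDerivAt.comp_hasDerivAt t hl, ?_⟩
  exact (ContinuousLinearMap.apply ℝ ℝ v).hasFDerivAt.comp_hasDerivAt t
    (h2.hasFDerivAt.comp_hasDerivAt t hl)

theorem ConvexOn.fderiv_fderiv_self_nonneg {f : E → ℝ} {S : Set E} (hS : IsOpen S)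
    (hf : ContDiff ℝ 2 f) (hconv : ConvexOn ℝ S f) {x : E} (hx : x ∈ S) (v : E) :
    0 ≤ fderiv ℝ (fderiv ℝ f) x v v := by
  have hd := hasDerivAt_fderiv_comp_line hf x v
  let ℓ : ℝ →ᵃ[ℝ] E := AffineMap.lineMap x (x + v)
  have hℓ : ⇑ℓ = fun t : ℝ => x + t • v := by
    ext t; simp [ℓ, AffineMap.lineMap_apply, add_comm]
  have hc : ConvexOn ℝ ((fun t : ℝ => x + t • v) ⁻¹' S) (fun t : ℝ => f (x + t • v)) := by
    have := hconv.comp_affineMap ℓ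
    rw [hℓ] at this
    exact this
  have hopen : IsOpen ((fun t : ℝ => x + t • v) ⁻¹' S) := hS.preimage (by fun_prop)
  have h0 : (0 : ℝ) ∈ (fun t : ℝ => x + t • v) ⁻¹' S := by simpa using hx
  have hmono := hc.monotoneOn_deriv fun t _ => (hd t).1.differentiableAt
  have hderiv : deriv (fun t : ℝ => f (x + t • v)) = fun t => fderiv ℝ f (x + t • v) v :=
    funext fun t => (hd t).1.deriv
  rw [hderiv] at hmono
  have := hmono.derivWithin_nonneg (x := 0)
  rw [((hd 0).2.hasDerivWithinAt).derivWithin (hopen.uniqueDiffWithinAt h0)] at this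
  simpa using this

/-- Polarisation: for unit vectors, `4 B v w` is a difference of two terms of size at most `4 C`. -/
theorem ContinuousLinearMap.norm_le_of_abs_apply_self_le {B : E →L[ℝ] E →L[ℝ] ℝ} {C : ℝ}
    (hC : 0 ≤ C) (hsymm : ∀ v w, B v w = B w v) (hB : ∀ v, |B v v| ≤ C * ‖v‖ ^ 2) :
    ‖B‖ ≤ 2 * C := by
  refine ContinuousLinearMap.opNorm_le_of_unit_norm (by positivity) fun v hv => ?_
  refine ContinuousLinearMap.opNorm_le_of_unit_norm (by positivity) fun w hw => ?_
  have hpol : B (v + w) (v + w) - B (v - w) (v - w) = 4 * B v w := by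
    simp only [map_add, map_sub, add_apply, sub_apply,
      hsymm w v]
    ring
  have h1 : ‖v + w‖ ≤ 2 := (norm_add_le v w).trans (by rw [hv, hw]; norm_num)
  have h2 : ‖v - w‖ ≤ 2 := (norm_sub_le v w).trans (by rw [hv, hw]; norm_num)
  have h1' : ‖v + w‖ ^ 2 ≤ 4 := by nlinarith [norm_nonneg (v + w)]
  have h2' : ‖v - w‖ ^ 2 ≤ 4 := by nlinarith [norm_nonneg (v - w)]
  have h3 := abs_le.1 ((hB (v + w)).trans (mul_le_mul_of_nonneg_left h1' hC))
  have h4 := abs_le.1 ((hB (v - w)).trans (mul_le_mul_of_nonneg_left h2' hC))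
  rw [Real.norm_eq_abs, abs_le]
  constructor <;> linarith [h3.1, h3.2, h4.1, h4.2]

open Filter Topology Metric

theorem UniformCauchySeqOn.exists_tendstoUniformlyOn {α G : Type*} [UniformSpace G]
    [CompleteSpace G] [Inhabited G] {g : ℕ → α → G} {s : Set α} (hg : UniformCauchySeqOn g atTop s) :
    ∃ g', TendstoUniformlyOn g g' atTop s := by
  classical
  have : ∀ x, ∃ y, x ∈ s → Tendsto (fun k => g k x) atTop (𝓝 y) := by
    intro x
    by_cases hx : x ∈ s
    · obtain ⟨y, hy⟩ := cauchySeq_tendsto_of_complete (hg.cauchySeq hx)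
      exact ⟨y, fun _ => hy⟩
    · exact ⟨default, fun h => absurd h hx⟩
  choose g' hg' using this
  exact ⟨g', hg.tendstoUniformlyOn_of_tendsto fun x hx => hg' x hx⟩

theorem uniformCauchySeqOn_of_norm_sub_lt {α G : Type*} [NormedAddCommGroup G] {g : ℕ → α → G}
    {s : Set α} (h : ∀ ε > 0, ∃ N, ∀ k ≥ N, ∀ l ≥ N, ∀ y ∈ s, ‖g k y - g l y‖ < ε) :
    UniformCauchySeqOn g atTop s :=
  Metric.uniformCauchySeqOn_iff.2 (by simpa only [dist_eq_norm] using h)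

theorem fderiv_zero_of_even {f : E → ℝ} (hf : DifferentiableAt ℝ f 0) (heven : ∀ x, f (-x) = f x) :
    fderiv ℝ f 0 = 0 := by
  have h1 : HasFDerivAt f (fderiv ℝ f 0) (-0) := by rw [neg_zero]; exact hf.hasFDerivAt
  have h2 := h1.comp (0 : E) (hasFDerivAt_id (𝕜 := ℝ) (0 : E)).neg
  have h3 : f ∘ (fun x => -id x) = f := funext heven
  have h4 := (hf.hasFDerivAt).unique (h3 ▸ h2)
  ext v
  have h5 := congrArg (fun L : E →L[ℝ] ℝ => L v) h4
  simp at h5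
  simp only [zero_apply]
  linarith

/-- If the second derivatives of `f k` are uniformly Cauchy on a ball, the first derivatives
converge at the centre, and `f k` converges pointwise to `F`, then `F` is `C²` on the ball. -/
theorem contDiffAt_two_of_uniformCauchySeqOn {f : ℕ → E → ℝ} {F : E → ℝ} {c x : E} {r : ℝ}
    (hf : ∀ k, ContDiff ℝ 2 (f k))
    (h2 : ∀ ε > 0, ∃ N, ∀ k ≥ N, ∀ l ≥ N, ∀ y ∈ ball c r,
      ‖fderiv ℝ (fderiv ℝ (f k)) y - fderiv ℝ (fderiv ℝ (f l)) y‖ < ε)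
    (h1 : CauchySeq fun k => fderiv ℝ (f k) c)
    (h0 : ∀ y ∈ ball c r, Tendsto (fun k => f k y) atTop (𝓝 (F y))) (hx : x ∈ ball c r) :
    ContDiffAt ℝ 2 F x := by
  replace h2 : UniformCauchySeqOn (fun k => fderiv ℝ (fderiv ℝ (f k))) atTop (ball c r) :=
    uniformCauchySeqOn_of_norm_sub_lt (G := E →L[ℝ] E →L[ℝ] ℝ) h2
  have hd1 : ∀ k y, HasFDerivAt (f k) (fderiv ℝ (f k) y) y := fun k y =>
    ((hf k).differentiable (by norm_num) y).hasFDerivAt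
  have hC1 : ∀ k, ContDiff ℝ 1 (fderiv ℝ (f k)) := fun k => (hf k).fderiv_right (by norm_num)
  have hd2 : ∀ k y, HasFDerivAt (fderiv ℝ (f k)) (fderiv ℝ (fderiv ℝ (f k)) y) y := fun k y =>
    ((hC1 k).differentiable (by norm_num) y).hasFDerivAt
  have hC0 : ∀ k, Continuous (fderiv ℝ (fderiv ℝ (f k))) := fun k =>
    (hC1 k).continuous_fderiv (by norm_num)
  have hcauchy : UniformCauchySeqOn (fun k => fderiv ℝ (f k)) atTop (ball c r) :=
    uniformCauchySeqOn_ball_of_fderiv h2 (fun k y _ => hd2 k y) h1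
  obtain ⟨G, hG⟩ := hcauchy.exists_tendstoUniformlyOn
  obtain ⟨H, hH⟩ := h2.exists_tendstoUniformlyOn
  have hF : ∀ y ∈ ball c r, HasFDerivAt F (G y) y := fun y hy =>
    hasFDerivAt_of_tendstoUniformlyOn isOpen_ball hG (fun k y _ => hd1 k y) h0 hy
  have hG' : ∀ y ∈ ball c r, HasFDerivAt G (H y) y := fun y hy =>
    hasFDerivAt_of_tendstoUniformlyOn isOpen_ball hH (fun k y _ => hd2 k y)
      (fun y hy => hG.tendsto_at hy) hy
  have hHc : ContinuousOn H (ball c r) :=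
    hH.continuousOn (Eventually.of_forall fun k => (hC0 k).continuousOn).frequently
  have hnhds : ball c r ∈ 𝓝 x := isOpen_ball.mem_nhds hx
  refine (contDiffAt_succ_iff_hasFDerivAt (n := 1)).2 ⟨G, ⟨_, hnhds, hF⟩, ?_⟩
  refine (contDiffAt_succ_iff_hasFDerivAt (n := 0)).2 ⟨H, ⟨_, hnhds, hG'⟩, ?_⟩
  exact contDiffAt_zero.2 ⟨_, hnhds, hHc⟩

end Calculus

/-! ### Approximation by even polynomials -/

section EvenPolynomials

open Polynomial

theorem Polynomial.exists_derivative_derivative_comp_sq (r : ℝ[X]) :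
    ∃ Q : ℝ[X], derivative (derivative (Q.comp (X ^ 2))) = r.comp (X ^ 2) := by
  induction r using Polynomial.induction_on' with
  | add p q hp hq =>
    obtain ⟨P, hP⟩ := hp
    obtain ⟨Q, hQ⟩ := hq
    exact ⟨P + Q, by simp only [add_comp, derivative_add, hP, hQ]⟩
  | monomial j c =>
    refine ⟨C (c / ((2 * j + 2) * (2 * j + 1))) * X ^ (j + 1), ?_⟩
    have h1 : (2 * (j : ℝ) + 2) ≠ 0 := by positivity
    have h2 : (2 * (j : ℝ) + 1) ≠ 0 := by positivity
    have h3 : 2 * (j + 1) = 2 * j + 1 + 1 := by ring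
    simp only [← C_mul_X_pow_eq_monomial, mul_comp, C_comp, pow_comp, X_comp, ← pow_mul, h3,
      derivative_C_mul, derivative_X_pow]
    simp only [Nat.add_sub_cancel, ← mul_assoc, ← C_mul]
    congr 2
    push_cast
    field_simp
    ring

theorem exists_even_polynomial_approx {h : ℝ → ℝ} (hh : ContDiff ℝ 2 h)
    (heven : ∀ s, h (-s) = h s) {R η : ℝ} (hR : 0 ≤ R) (hη : 0 < η) :
    ∃ Q : ℝ[X], (∀ s ∈ Set.Icc (-R) R,
        |(derivative (derivative (Q.comp (X ^ 2)))).eval s - deriv (deriv h) s| ≤ η) ∧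
      ∀ s ∈ Set.Icc 0 R, |Q.eval (s ^ 2) - h s| ≤ η * R * R := by
  have hC1 : ContDiff ℝ 1 (deriv h) := ((contDiff_succ_iff_deriv (n := 1)).1 hh).2.2
  have hC0 : Continuous (deriv (deriv h)) := hC1.continuous_deriv (by norm_num)
  have hodd : ∀ s, deriv h (-s) = -deriv h s := by
    intro s
    have h1 : (fun s => h (-s)) = h := funext heven
    have := deriv_comp_neg h s
    rw [h1] at this
    linarith
  have heven2 : ∀ s, deriv (deriv h) (-s) = deriv (deriv h) s := by
    intro s
    have h1 : (fun s => deriv h (-s)) = fun s => -deriv h s := funext hodd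
    have := deriv_comp_neg (deriv h) s
    rw [h1, deriv.fun_neg] at this
    linarith
  -- Weierstrass approximation in the variable `t = s²`, so that the approximant `r (s²)` is even.
  obtain ⟨r, hr⟩ := exists_polynomial_near_of_continuousOn 0 (R ^ 2)
    (fun t => deriv (deriv h) √t) (hC0.comp Real.continuous_sqrt).continuousOn η hη
  obtain ⟨Q₀, hQ₀⟩ := Polynomial.exists_derivative_derivative_comp_sq r
  -- The constant matches the values at `0`; the derivatives there vanish by evenness. Integrating
  -- the error `η` twice from `0` gives `η * R * R`.
  let Q : ℝ[X] := Q₀ + C (h 0 - Q₀.eval 0)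
  have hQ : derivative (derivative (Q.comp (X ^ 2))) = r.comp (X ^ 2) := by
    simp only [Q, add_comp, derivative_add, C_comp, derivative_C, add_zero, hQ₀]
  have hbound : ∀ s ∈ Set.Icc (-R) R,
      |(derivative (derivative (Q.comp (X ^ 2)))).eval s - deriv (deriv h) s| ≤ η := by
    intro s hs
    have hs2 : s ^ 2 ∈ Set.Icc 0 (R ^ 2) := ⟨sq_nonneg s, sq_le_sq' hs.1 hs.2⟩
    have := (hr _ hs2).le
    rw [hQ]
    simp only [Real.sqrt_sq_eq_abs] at this
    have habs : deriv (deriv h) |s| = deriv (deriv h) s := by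
      rcases abs_choice s with h | h <;> rw [h]
      exact heven2 s
    rw [habs] at this
    simpa using this
  refine ⟨Q, hbound, ?_⟩
  set P := Q.comp (X ^ 2) with hP
  have he1 : ∀ s, HasDerivAt (fun s => P.eval s - h s) ((derivative P).eval s - deriv h s) s :=
    fun s => (P.hasDerivAt s).sub ((hh.differentiable (by norm_num)) s).hasDerivAt
  have he2 : ∀ s, HasDerivAt (fun s => (derivative P).eval s - deriv h s)
      ((derivative (derivative P)).eval s - deriv (deriv h) s) s :=
    fun s => ((derivative P).hasDerivAt s).sub ((hC1.differentiable (by norm_num)) s).hasDerivAt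
  have hP0 : P.eval 0 - h 0 = 0 := by simp [hP, Q]
  have hP1 : (derivative P).eval 0 - deriv h 0 = 0 := by
    have h0 : deriv h 0 = 0 := by have := hodd 0; rw [neg_zero] at this; linarith
    rw [h0, hP, derivative_comp]
    simp
  have hstep : ∀ (g g' : ℝ → ℝ) (K : ℝ), (∀ s, HasDerivAt g (g' s) s) → g 0 = 0 → 0 ≤ K →
      (∀ s ∈ Set.Icc 0 R, |g' s| ≤ K) → ∀ s ∈ Set.Icc 0 R, |g s| ≤ K * R := by
    intro g g' K hg hg0 hK hb s hs
    have := (convex_Icc 0 R).norm_image_sub_le_of_norm_hasDerivWithin_le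
      (fun x _ => (hg x).hasDerivWithinAt) hb (Set.left_mem_Icc.2 hR) hs
    rw [hg0, sub_zero, sub_zero, Real.norm_eq_abs, Real.norm_eq_abs, abs_of_nonneg hs.1] at this
    exact this.trans (mul_le_mul_of_nonneg_left hs.2 hK)
  have hs1 := hstep _ _ η he2 hP1 hη.le
    fun s hs => hbound s ⟨by linarith [hs.1], hs.2⟩
  have hs0 := hstep _ _ (η * R) he1 hP0 (by positivity) hs1
  intro s hs
  simpa [hP] using hs0 s hs

end EvenPolynomials

/-! ### Hessian bounds for trace polynomials and `C²` regularity -/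

section TracePolynomials

open Polynomial Matrix Filter Topology Metric

variable {n : ℕ}

/-- The topology of the Frobenius norm, through which derivatives on matrices are taken. -/
@[reducible] noncomputable def frobeniusTopology : TopologicalSpace (Matrix (Fin n) (Fin n) ℝ) :=
  @UniformSpace.toTopologicalSpace _ (@PseudoMetricSpace.toUniformSpace _
    (@SeminormedAddCommGroup.toPseudoMetricSpace _ NormedAddCommGroup.toSeminormedAddCommGroup))

attribute [local instance] frobeniusTopology

/-- The function `p ↦ tr Q(p pᵀ)` attached to a polynomial `Q`. -/
noncomputable def tracePoly (Q : ℝ[X]) (p : Matrix (Fin n) (Fin n) ℝ) : ℝ :=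
  (aeval (p * pᵀ) Q).trace

theorem tracePoly_eq_singularSum (Q : ℝ[X]) (p : Matrix (Fin n) (Fin n) ℝ) :
    tracePoly Q p = singularSum (fun s => Q.eval (s ^ 2)) p := by
  rw [tracePoly, trace_aeval_mul_transpose, singularSum]
  exact Finset.sum_congr rfl fun i _ => by rw [Real.sq_sqrt (sigma_nonneg p i)]

theorem tracePoly_C_mul_X_add (c d : ℝ) (Q : ℝ[X]) (p : Matrix (Fin n) (Fin n) ℝ) :
    tracePoly (C c * X + C d * Q) p = c * tracePoly X p + d * tracePoly Q p := by
  simp [tracePoly, ← Algebra.smul_def, trace_add, trace_smul]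

theorem tracePoly_sub (P Q : ℝ[X]) (p : Matrix (Fin n) (Fin n) ℝ) :
    tracePoly (P - Q) p = tracePoly P p - tracePoly Q p := by
  simp [tracePoly, trace_sub]

theorem contDiff_mul_transpose_pow {m : ℕ∞} (k : ℕ) :
    ContDiff ℝ m fun p : Matrix (Fin n) (Fin n) ℝ => (p * pᵀ) ^ k := by
  let _ : NormedRing (Matrix (Fin n) (Fin n) ℝ) := Matrix.frobeniusNormedRing
  let _ : NormedAlgebra ℝ (Matrix (Fin n) (Fin n) ℝ) := Matrix.frobeniusNormedAlgebra
  have h : ContDiff ℝ m fun p : Matrix (Fin n) (Fin n) ℝ => pᵀ :=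
    (LinearMap.toContinuousLinearMap
      (transposeLinearEquiv (Fin n) (Fin n) ℝ ℝ).toLinearMap).contDiff
  exact (contDiff_id.mul h).pow k

theorem contDiff_tracePoly {m : ℕ∞} (Q : ℝ[X]) :
    ContDiff ℝ m (tracePoly Q : Matrix (Fin n) (Fin n) ℝ → ℝ) := by
  have h : (tracePoly Q : Matrix (Fin n) (Fin n) ℝ → ℝ) = fun p =>
      ∑ i ∈ Finset.range (Q.natDegree + 1), Q.coeff i * ((p * pᵀ) ^ i).trace := by
    ext p
    rw [tracePoly, aeval_eq_sum_range, trace_sum]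
    simp only [trace_smul, smul_eq_mul]
  rw [h]
  refine ContDiff.sum fun i _ => contDiff_const.mul ?_
  exact (LinearMap.toContinuousLinearMap
    (traceLinearMap (Fin n) ℝ ℝ)).contDiff.comp (contDiff_mul_transpose_pow i)

theorem fderiv_tracePoly_zero (Q : ℝ[X]) :
    fderiv ℝ (tracePoly Q : Matrix (Fin n) (Fin n) ℝ → ℝ) 0 = 0 := by
  refine fderiv_zero_of_even ((contDiff_tracePoly (m := 1) Q).differentiable (by norm_num) 0)
    fun p => ?_
  simp [tracePoly]

theorem fderiv_fderiv_tracePoly_C_mul_X_add (c d : ℝ) (Q : ℝ[X])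
    (x v : Matrix (Fin n) (Fin n) ℝ) :
    fderiv ℝ (fderiv ℝ (tracePoly (C c * X + C d * Q))) x v v =
      c * (2 * ‖v‖ ^ 2) + d * fderiv ℝ (fderiv ℝ (tracePoly Q)) x v v := by
  have hX : ∀ t : ℝ, tracePoly X (x + t • v) =
      (x * xᵀ).trace + t * (x * vᵀ + v * xᵀ).trace + t ^ 2 * ‖v‖ ^ 2 := by
    intro t
    rw [← trace_mul_transpose_self]
    simp only [tracePoly, aeval_X, transpose_add, transpose_smul, add_mul, mul_add, smul_mul,
      Matrix.mul_smul, trace_add, trace_smul, smul_eq_mul]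
    ring
  have hQ := hasDerivAt_fderiv_comp_line (contDiff_tracePoly (m := 2) Q) x v
  have hP := hasDerivAt_fderiv_comp_line (contDiff_tracePoly (m := 2) (C c * X + C d * Q)) x v
  have h1 : ∀ t : ℝ, fderiv ℝ (tracePoly (C c * X + C d * Q)) (x + t • v) v =
      c * ((x * vᵀ + v * xᵀ).trace + 2 * t * ‖v‖ ^ 2) +
        d * fderiv ℝ (tracePoly Q) (x + t • v) v := by
    intro t
    refine (hP t).1.unique ?_
    simp only [tracePoly_C_mul_X_add, hX]
    refine HasDerivAt.add (HasDerivAt.const_mul _ ?_) ((hQ t).1.const_mul d)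
    have ha := ((hasDerivAt_id t).mul_const (x * vᵀ + v * xᵀ).trace).const_add (x * xᵀ).trace
    have hb := ((hasDerivAt_id t).pow 2).mul_const (‖v‖ ^ 2)
    convert! ha.add hb using 1
    simp
  have h2 := (hP 0).2
  simp only [h1] at h2
  have h3 : HasDerivAt (fun t : ℝ => c * ((x * vᵀ + v * xᵀ).trace + 2 * t * ‖v‖ ^ 2) +
        d * fderiv ℝ (tracePoly Q) (x + t • v) v)
      (c * (2 * ‖v‖ ^ 2) + d * fderiv ℝ (fderiv ℝ (tracePoly Q)) (x + (0 : ℝ) • v) v v) 0 := by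
    refine HasDerivAt.add (HasDerivAt.const_mul _ (HasDerivAt.const_add _ ?_))
      ((hQ 0).2.const_mul d)
    simpa using (((hasDerivAt_id (0 : ℝ)).const_mul 2).mul_const (‖v‖ ^ 2))
  simpa using h2.unique h3

/-- The term `(η/2) s²` has second derivative `η`, which absorbs that of `d * Q (s²)`. -/
theorem convexOn_eval_sq_add {Q : ℝ[X]} {R η d : ℝ} (hd : |d| ≤ 1)
    (hQ : ∀ s ∈ Set.Icc (-R) R, |(derivative (derivative (Q.comp (X ^ 2)))).eval s| ≤ η) :
    ConvexOn ℝ (Set.Icc (-R) R) fun s => (C (η / 2) * X + C d * Q).eval (s ^ 2) := by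
  set S := (C (η / 2) * X + C d * Q).comp (X ^ 2) with hS
  have h : (fun s => (C (η / 2) * X + C d * Q).eval (s ^ 2)) = fun s => S.eval s := by
    ext s; simp [hS]
  have hS2 : derivative (derivative S) = C η + C d * derivative (derivative (Q.comp (X ^ 2))) := by
    have h2 : C (η / 2) * (C 2 : ℝ[X]) = C η := by rw [← C_mul]; congr 1; ring
    simp only [hS, add_comp, mul_comp, C_comp, X_comp, derivative_add, derivative_C_mul,
      derivative_X_pow]
    simp only [← h2]
    simp
  have hd1 : deriv (fun s => S.eval s) = fun s => (derivative S).eval s :=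
    funext fun s => S.deriv
  have hd2 : deriv (fun s => (derivative S).eval s) = fun s => (derivative (derivative S)).eval s :=
    funext fun s => (derivative S).deriv
  rw [h]
  refine convexOn_of_deriv2_nonneg' (convex_Icc _ _) S.differentiable.differentiableOn ?_ ?_
  · rw [hd1]
    exact (derivative S).differentiable.differentiableOn
  · intro s hs
    simp only [Function.iterate_succ, Function.iterate_zero, Function.comp_apply, id, hd1, hd2, hS2,
      eval_add, eval_mul, eval_C]
    have h1 := hQ s hs
    have h2 := mul_le_mul hd h1 (abs_nonneg _) zero_le_one
    rw [← abs_mul, one_mul] at h2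
    linarith [(abs_le.1 h2).1]

/-- Taking `d = ±1` in the convex perturbation bounds the quadratic form by `η ‖v‖²`; polarisation
costs the factor 2. No differentiability of eigenvalues is involved. -/
theorem norm_fderiv_fderiv_tracePoly_le {Q : ℝ[X]} {R η : ℝ} (hη : 0 ≤ η)
    (hQ : ∀ s ∈ Set.Icc (-R) R, |(derivative (derivative (Q.comp (X ^ 2)))).eval s| ≤ η)
    {x : Matrix (Fin n) (Fin n) ℝ} (hx : x ∈ ball 0 R) :
    ‖fderiv ℝ (fderiv ℝ (tracePoly Q)) x‖ ≤ 2 * η := by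
  have hnonneg : ∀ d : ℝ, |d| ≤ 1 → ∀ v : Matrix (Fin n) (Fin n) ℝ,
      0 ≤ η * ‖v‖ ^ 2 + d * fderiv ℝ (fderiv ℝ (tracePoly Q)) x v v := by
    intro d hd v
    have hc : ConvexOn ℝ (ball (0 : Matrix (Fin n) (Fin n) ℝ) R)
        (tracePoly (C (η / 2) * X + C d * Q)) := by
      have := convexOn_singularSum (convexOn_eval_sq_add hd hQ) (fun s => by rw [neg_sq])
        (convex_ball (0 : Matrix (Fin n) (Fin n) ℝ) R)
        fun q hq j => (sqrt_sigma_le_norm q j).trans (mem_ball_zero_iff.1 hq).le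
      exact this.congr fun p _ => (tracePoly_eq_singularSum _ p).symm
    have := hc.fderiv_fderiv_self_nonneg isOpen_ball (contDiff_tracePoly (m := 2) _) hx v
    rw [fderiv_fderiv_tracePoly_C_mul_X_add] at this
    linarith
  refine ContinuousLinearMap.norm_le_of_abs_apply_self_le hη ?_ fun v => ?_
  · exact (((contDiff_tracePoly (m := 2) Q).contDiffAt (x := x)).isSymmSndFDerivAt (by simp)).eq
  · have h1 := hnonneg 1 (by simp) v
    have h2 := hnonneg (-1) (by simp) v
    rw [abs_le]
    constructor <;> linarith

/-- A symmetric `C²` function of the singular values is `C²`. -/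
theorem contDiff_singularSum {h : ℝ → ℝ} (hh : ContDiff ℝ 2 h) (heven : ∀ s, h (-s) = h s) :
    ContDiff ℝ 2 (singularSum h : Matrix (Fin n) (Fin n) ℝ → ℝ) := by
  rw [contDiff_iff_contDiffAt]
  intro x
  set R := ‖x‖ + 1 with hR
  have hR0 : 0 ≤ R := by positivity
  have hx : x ∈ ball (0 : Matrix (Fin n) (Fin n) ℝ) R := by
    rw [mem_ball_zero_iff]; linarith
  have hη : ∀ k : ℕ, (0 : ℝ) < 1 / ((k : ℝ) + 1) := fun k => by positivity
  choose Q hQ2 hQ0 using fun k => exists_even_polynomial_approx hh heven hR0 (hη k)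
  have hlim : Tendsto (fun k : ℕ => 1 / ((k : ℝ) + 1)) atTop (𝓝 0) :=
    tendsto_one_div_add_atTop_nhds_zero_nat
  -- The ball is centred at `0` because every `tracePoly` is even, so all first derivatives vanish
  -- there.
  refine contDiffAt_two_of_uniformCauchySeqOn (f := fun k => tracePoly (Q k)) (c := 0) (r := R)
    (fun k => contDiff_tracePoly (m := 2) _) ?_ ?_ ?_ hx
  · intro ε hε
    obtain ⟨N, hN⟩ := eventually_atTop.1
      (hlim.eventually (gt_mem_nhds (show 0 < ε / 4 by positivity)))
    refine ⟨N, fun k hk l hl y hy => ?_⟩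
    have hC1 : ∀ P : ℝ[X], ContDiff ℝ 1 (fderiv ℝ (tracePoly P : Matrix (Fin n) (Fin n) ℝ → ℝ)) :=
      fun P => (contDiff_tracePoly (m := 2) P).fderiv_right (by norm_num)
    have hdiff : fderiv ℝ (fderiv ℝ (tracePoly (Q k))) y - fderiv ℝ (fderiv ℝ (tracePoly (Q l))) y
        = fderiv ℝ (fderiv ℝ (tracePoly (Q k - Q l))) y := by
      have h1 : (fderiv ℝ (tracePoly (Q k - Q l)) : Matrix (Fin n) (Fin n) ℝ → _) =
          fun z => fderiv ℝ (tracePoly (Q k)) z - fderiv ℝ (tracePoly (Q l)) z := by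
        ext1 z
        rw [← fderiv_fun_sub ((contDiff_tracePoly (m := 1) (Q k)).differentiable (by norm_num) z)
          ((contDiff_tracePoly (m := 1) (Q l)).differentiable (by norm_num) z)]
        simp only [← tracePoly_sub]
      rw [h1, fderiv_fun_sub ((hC1 _).differentiable (by norm_num) y)
        ((hC1 _).differentiable (by norm_num) y)]
    rw [hdiff]
    refine (norm_fderiv_fderiv_tracePoly_le (add_pos (hη k) (hη l)).le (fun s hs => ?_) hy).trans_lt
      (by linarith [hN k hk, hN l hl])
    rw [sub_comp, derivative_sub, derivative_sub, eval_sub]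
    have := abs_sub_le ((derivative (derivative ((Q k).comp (X ^ 2)))).eval s)
      (deriv (deriv h) s) ((derivative (derivative ((Q l).comp (X ^ 2)))).eval s)
    have h2 := hQ2 l s hs
    rw [abs_sub_comm] at h2
    linarith [hQ2 k s hs]
  · simp only [fderiv_tracePoly_zero]
    exact cauchySeq_const _
  · intro y hy
    simp only [tracePoly_eq_singularSum]
    refine tendsto_finsetSum _ fun i _ => ?_
    have hs : √(sigma y i) ∈ Set.Icc 0 R :=
      ⟨Real.sqrt_nonneg _, (sqrt_sigma_le_norm y i).trans (mem_ball_zero_iff.1 hy).le⟩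
    rw [tendsto_iff_norm_sub_tendsto_zero]
    refine squeeze_zero (fun _ => norm_nonneg _) (fun k => hQ0 k _ hs) ?_
    simpa using (hlim.mul_const R).mul_const R

end TracePolynomials

/-! ### The generating function and the conclusion -/

/-- The function is the `ℓ⁴` norm of `(√|ε|, s)`, so Minkowski's inequality applies. -/
theorem convexOn_rpow_sq_add_pow_four (ε : ℝ) :
    ConvexOn ℝ Set.univ fun s : ℝ => (ε ^ 2 + s ^ 4) ^ (1 / 4 : ℝ) := by
  let v : ℝ → Fin 2 → ℝ := fun s => ![√|ε|, s]
  have hN : ∀ c s : ℝ, 0 ≤ c →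
      (∑ i, |c * v s i| ^ (4 : ℝ)) ^ (1 / 4 : ℝ) = c * (ε ^ 2 + s ^ 4) ^ (1 / 4 : ℝ) := by
    intro c s hc
    have h4 : ∀ x : ℝ, |x| ^ (4 : ℝ) = x ^ 4 := fun x => by
      rw [show (4 : ℝ) = ((4 : ℕ) : ℝ) by norm_num, Real.rpow_natCast]
      exact Even.pow_abs (by decide) x
    have hε : √|ε| ^ 4 = ε ^ 2 := by
      rw [show √|ε| ^ 4 = (√|ε| ^ 2) ^ 2 by ring, Real.sq_sqrt (abs_nonneg _), sq_abs]
    simp only [h4, Fin.sum_univ_two, v, Matrix.cons_val_zero, Matrix.cons_val_one, mul_pow, hε]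
    rw [← mul_add, Real.mul_rpow (by positivity) (by positivity)]
    congr 1
    rw [← Real.rpow_natCast, ← Real.rpow_mul hc]
    norm_num
  refine ⟨convex_univ, fun x _ y _ a b ha hb hab => ?_⟩
  have := Real.Lp_add_le Finset.univ (fun i => a * v x i) (fun i => b * v y i)
    (show (1 : ℝ) ≤ 4 by norm_num)
  rw [hN a x ha, hN b y hb] at this
  have hsum : ∀ i, a * v x i + b * v y i = 1 * v (a • x + b • y) i := by
    intro i
    fin_cases i
    · simp [v, ← add_mul, hab]
    · simp [v]
  simp only [hsum] at this
  rw [hN 1 _ zero_le_one, one_mul] at this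
  simpa using this

theorem theorem4p1 (n : ℕ) (ε : ℝ) (hε : 0 < ε) (ψ : ℝ → ℝ) (ν₁ ν₂ ν₃ : ℝ)
    (hν₁ : 0 < ν₁) (hν₂ : 0 < ν₂) (hψ : IsGenerator ψ ν₁ ν₂ ν₃) :
    ConvexOn ℝ Set.univ (fun p : Matrix (Fin n) (Fin n) ℝ => Fstar ψ ε p) ∧
      ContDiff ℝ 2 (fun p : Matrix (Fin n) (Fin n) ℝ => Fstar ψ ε p) := by
  let h : ℝ → ℝ := fun s => ψ ((ε ^ 2 + s ^ 4) ^ (1 / 4 : ℝ))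
  have heven : ∀ s, h (-s) = h s := fun s => by
    simp only [h, Even.neg_pow (show Even 4 by decide)]
  have hF : (fun p : Matrix (Fin n) (Fin n) ℝ => Fstar ψ ε p) = singularSum h := by
    ext p
    refine Finset.sum_congr rfl fun i _ => ?_
    simp only [h]
    rw [show √(sigma p i) ^ 4 = (√(sigma p i) ^ 2) ^ 2 by ring, Real.sq_sqrt (sigma_nonneg p i)]
  have hsmooth : ContDiff ℝ 2 h := by
    refine hψ.contDiff.comp (ContDiff.rpow_const_of_ne (by fun_prop) fun s => ?_)
    positivity
  have hconv : ConvexOn ℝ Set.univ h := by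
    refine ⟨convex_univ, fun x _ y _ a b ha hb hab => ?_⟩
    refine (hψ.increasing ?_ ?_ ((convexOn_rpow_sq_add_pow_four ε).2 (Set.mem_univ x)
      (Set.mem_univ y) ha hb hab)).trans
      (hψ.convex.2 (Set.mem_univ _) (Set.mem_univ _) ha hb hab)
    · simp only [Set.mem_Ici]; positivity
    · simp only [Set.mem_Ici, smul_eq_mul]; positivity
  rw [hF]
  refine ⟨⟨convex_univ, fun p _ q _ a b ha hb hab => ?_⟩, contDiff_singularSum hsmooth heven⟩
  -- Any two matrices lie in a common closed ball, which reduces global convexity to the bounded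
  -- version.
  have hc := convexOn_singularSum
    (hconv.subset (Set.subset_univ (Set.Icc (-max ‖p‖ ‖q‖) (max ‖p‖ ‖q‖))) (convex_Icc _ _)) heven
    (convex_closedBall (0 : Matrix (Fin n) (Fin n) ℝ) (max ‖p‖ ‖q‖))
    fun r hr j => (sqrt_sigma_le_norm r j).trans (mem_closedBall_zero_iff.1 hr)
  exact hc.2 (mem_closedBall_zero_iff.2 (le_max_left _ _))
    (mem_closedBall_zero_iff.2 (le_max_right _ _)) ha hb hab
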